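/- For a graph $F$, a hypergraph $H$ (a vertex set together with a set of distinct vertex subsets, its edges) is a Berge-$F$ if, after identifying the vertices of $F$ with distinct vertices of $H$, there is a bijection $f : E(F) \to E(H)$ such that $e \subseteq f(e)$ for every $e \in E(F)$. Let $\mathrm{ex}_r(n, \text{Berge-}F)$ denote the maximum number of edges in an $r$-uniform hypergraph on $n$ vertices that contains no subhypergraph isomorphic to a Berge-$F$. Let $K_{s,t}$ be the complete bipartite graph with parts of sizes $s$ and $t$. Theorem. For all integers $3 \le r \le s \le t$ there are a constant $C > 0$ and an integer $n_0$, depending only on $r$, $s$ and $t$, such that for all $n \ge n_0$, $$\mathrm{ex}_r(n, \text{Berge-}K_{s,t}) \le C\, n^{\,r - \frac{r(r-1)}{2s}}.$$ -/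

import Mathlib

/-- `H'` is a subhypergraph of `H`: its vertices and its edges are among those of `H`. -/
def Hypergraph.IsSubhypergraph {β : Type*} (H' H : Hypergraph β) : Prop :=
  H'.vertexSet ⊆ H.vertexSet ∧ H'.edgeSet ⊆ H.edgeSet

/-- `H` is `r`-uniform: every edge has exactly `r` vertices. -/
def Hypergraph.IsUniform {β : Type*} (H : Hypergraph β) (r : ℕ) : Prop :=
  ∀ e ∈ H.edgeSet, e.encard = r

/-- `H` is (isomorphic to) a Berge-`F`: after placing the vertices of `F` injectively among the
vertices of `H` by `φ`, there is a bijection `f : E(F) → E(H)` such that `e ⊆ f(e)` for every edge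
`e` of `F`. -/
def Hypergraph.IsBerge {W β : Type*} (H : Hypergraph β) (F : SimpleGraph W) : Prop :=
  ∃ φ : W ↪ β, (∀ w, φ w ∈ H.vertexSet) ∧
    ∃ f : F.edgeSet ≃ H.edgeSet,
      ∀ e : F.edgeSet, ∀ w ∈ (e : Sym2 W), φ w ∈ (f e : Set β)

/-- `H` contains no subhypergraph isomorphic to a member of Berge-`F`. -/
def Hypergraph.BergeFree {W β : Type*} (H : Hypergraph β) (F : SimpleGraph W) : Prop :=
  ∀ H' : Hypergraph β, H'.IsSubhypergraph H → ¬ H'.IsBerge F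

/-- The possible numbers of edges of an `r`-uniform hypergraph on `n` vertices that contains
no Berge-`F`. -/
def bergeFreeSizes {W : Type*} (r n : ℕ) (F : SimpleGraph W) : Set ℕ :=
  {m | ∃ H : Hypergraph (Fin n), H.vertexSet = Set.univ ∧ H.IsUniform r ∧ H.BergeFree F ∧
    H.edgeSet.ncard = m}

/-- `ex_r(n, Berge-F)`: the maximum number of edges in an `r`-uniform hypergraph on `n` vertices
that contains no Berge-`F`. -/
noncomputable def bergeEx {W : Type*} (r n : ℕ) (F : SimpleGraph W) : ℕ :=
  sSup (bergeFreeSizes r n F)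

/-- As soon as `F` has an edge, `bergeEx r n F` is an attained maximum. -/
theorem bergeEx_isGreatest {W : Type*} (r n : ℕ) (F : SimpleGraph W) (hF : F.edgeSet.Nonempty) :
    IsGreatest (bergeFreeSizes r n F) (bergeEx r n F) := by
  have hb : BddAbove (bergeFreeSizes r n F) := by
    refine ⟨Nat.card (Set (Fin n)), ?_⟩
    rintro m ⟨H, -, -, -, rfl⟩
    exact Set.ncard_le_card _
  have hne : (bergeFreeSizes r n F).Nonempty := by
    refine ⟨0, Hypergraph.trivialOn Set.univ, rfl, ?_, ?_, by simp⟩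
    · intro e he
      simp at he
    · rintro H' ⟨-, h⟩ ⟨φ, -, f, -⟩
      obtain ⟨e, he⟩ := hF
      have := h (f ⟨e, he⟩).2
      simp at this
  exact ⟨Nat.sSup_mem hne hb, fun m hm => le_csSup hb hm⟩

/-! Take a maximal matching between pairs of vertices and hyperedges containing them, and let G be
the graph of matched pairs. A copy of K_{s,t} in G would extend along the matching to a
Berge-K_{s,t}, so G is K_{s,t}-free. By maximality an unmatched hyperedge spans a clique of G, so
the hyperedges number at most the r-cliques plus the edges of G.

Cliques are counted by induction on their size: a neighbourhood in G is K_{s-1,t}-free, so v lies in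
O(d(v)^a) of them, a being the exponent for (r-1, s-1). Counting stars gives ∑ d(v)^s = O(n^s), and
since a ≤ s this bounds ∑ d(v)^a as if every degree were n^(1-1/s). -/

open Classical in
/-- The neighbours of `v` inside `A`. -/
noncomputable def SimpleGraph.nbrsIn {V : Type*} (G : SimpleGraph V) (A : Finset V) (v : V) :
    Finset V :=
  A.filter (fun u => G.Adj v u)

open Classical in
/-- The cliques with `m` vertices inside `A`. -/
noncomputable def SimpleGraph.cliquesIn {V : Type*} (G : SimpleGraph V) (A : Finset V) (m : ℕ) :
    Finset (Finset V) :=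
  (A.powersetCard m).filter (fun K => G.IsClique (K : Set V))

/-- Inside `A`, every `s` vertices have fewer than `t` common neighbours. -/
def SimpleGraph.FewCommonNbrs {V : Type*} (G : SimpleGraph V) (A : Finset V) (s t : ℕ) : Prop :=
  ∀ S ⊆ A, S.card = s → ∀ T ⊆ A, (∀ v ∈ T, ∀ u ∈ S, G.Adj v u) → T.card < t

namespace SimpleGraph

variable {V : Type*} {G : SimpleGraph V} {A : Finset V} {s t : ℕ}

theorem nbrsIn_subset (G : SimpleGraph V) (A : Finset V) (v : V) : G.nbrsIn A v ⊆ A := by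
  classical
  exact Finset.filter_subset _ _

theorem mem_cliquesIn {m : ℕ} {K : Finset V} :
    K ∈ G.cliquesIn A m ↔ (K ⊆ A ∧ K.card = m) ∧ G.IsClique (K : Set V) := by
  classical
  simp only [cliquesIn, Finset.mem_filter, Finset.mem_powersetCard]

/-- Within its neighbourhood, `v` can be adjoined to any set `S` without losing common neighbours.
-/
theorem FewCommonNbrs.nbrsIn (h : G.FewCommonNbrs A (s + 1) t) {v : V} (hv : v ∈ A) :
    G.FewCommonNbrs (G.nbrsIn A v) s t := by
  classical
  intro S hS hcard T hT hadj
  have hvS : v ∉ S := fun hmem => by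
    have := hS hmem
    simp [SimpleGraph.nbrsIn] at this
  have hSA : insert v S ⊆ A :=
    Finset.insert_subset hv (hS.trans (G.nbrsIn_subset A v))
  refine h (insert v S) hSA (by rw [Finset.card_insert_of_notMem hvS, hcard]) T
    (hT.trans (G.nbrsIn_subset A v)) fun w hw u hu => ?_
  rcases Finset.mem_insert.1 hu with rfl | hu
  · have := hT hw
    simp only [SimpleGraph.nbrsIn, Finset.mem_filter] at this
    exact this.2.symm
  · exact hadj w hw u hu

/-- Double counting of pairs (v, S) with S an `s`-subset of the neighbourhood of v. -/
theorem FewCommonNbrs.sum_choose_le (h : G.FewCommonNbrs A s t) :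
    ∑ v ∈ A, (G.nbrsIn A v).card.choose s ≤ t * A.card.choose s := by
  classical
  have h1 : ∀ v ∈ A, (G.nbrsIn A v).card.choose s =
      ∑ S ∈ A.powersetCard s, if ∀ u ∈ S, G.Adj v u then 1 else 0 := by
    intro v _
    rw [← Finset.card_powersetCard, ← Finset.sum_filter, Finset.sum_const, smul_eq_mul, mul_one]
    congr 1
    ext S
    simp only [Finset.mem_powersetCard, Finset.mem_filter, SimpleGraph.nbrsIn, Finset.subset_iff]
    grind
  rw [Finset.sum_congr rfl h1, Finset.sum_comm, mul_comm, ← Finset.card_powersetCard,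
    ← smul_eq_mul, ← Finset.sum_const]
  refine Finset.sum_le_sum fun S hS => ?_
  rw [Finset.mem_powersetCard] at hS
  rw [← Finset.sum_filter, Finset.sum_const, smul_eq_mul, mul_one]
  exact (h S hS.1 hS.2 _ (Finset.filter_subset _ _) fun v hv => (Finset.mem_filter.1 hv).2).le

end SimpleGraph

theorem Nat.pow_le_pow_mul_choose (d s : ℕ) :
    d ^ s ≤ s ^ s * (1 + s.factorial * d.choose s) := by
  rcases lt_or_ge d s with h | h
  · exact (Nat.pow_le_pow_left h.le s).trans (Nat.le_mul_of_pos_right _ (by positivity))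
  · rcases Nat.eq_zero_or_pos s with rfl | hs
    · simp
    have h1 : d ≤ s * (d + 1 - s) := by
      obtain ⟨k, rfl⟩ := Nat.exists_eq_add_of_le h
      have : s + k + 1 - s = k + 1 := by omega
      rw [this]
      nlinarith
    calc d ^ s ≤ (s * (d + 1 - s)) ^ s := Nat.pow_le_pow_left h1 s
      _ = s ^ s * (d + 1 - s) ^ s := mul_pow _ _ _
      _ ≤ s ^ s * d.descFactorial s :=
        Nat.mul_le_mul_left _ (Nat.pow_sub_le_descFactorial d s)
      _ = s ^ s * (s.factorial * d.choose s) := by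
        rw [Nat.descFactorial_eq_factorial_mul_choose]
      _ ≤ _ := Nat.mul_le_mul_left _ (by omega)

namespace SimpleGraph

variable {V : Type*} {G : SimpleGraph V} {A : Finset V} {s t : ℕ}

theorem FewCommonNbrs.sum_pow_le (h : G.FewCommonNbrs A s t) (hs : 1 ≤ s) :
    ∑ v ∈ A, (G.nbrsIn A v).card ^ s ≤ s ^ s * (1 + t) * A.card ^ s := by
  calc ∑ v ∈ A, (G.nbrsIn A v).card ^ s
      ≤ ∑ v ∈ A, s ^ s * (1 + s.factorial * (G.nbrsIn A v).card.choose s) :=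
        Finset.sum_le_sum fun v _ => Nat.pow_le_pow_mul_choose _ _
    _ = s ^ s * (A.card + s.factorial * ∑ v ∈ A, (G.nbrsIn A v).card.choose s) := by
        rw [← Finset.mul_sum, Finset.sum_add_distrib, ← Finset.mul_sum]
        simp
    _ ≤ s ^ s * (A.card + s.factorial * (t * A.card.choose s)) := by
        gcongr
        exact h.sum_choose_le
    _ = s ^ s * (A.card + t * A.card.descFactorial s) := by
        rw [Nat.descFactorial_eq_factorial_mul_choose]
        ring
    _ ≤ s ^ s * (A.card ^ s + t * A.card ^ s) := by
        gcongr
        · exact Nat.le_self_pow (by omega) _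
        · exact Nat.descFactorial_le_pow _ _
    _ = _ := by ring

end SimpleGraph

theorem Real.rpow_le_rpow_add_rpow_mul {x M a b : ℝ} (hx : 0 ≤ x) (hM : 0 < M) (ha : 0 ≤ a)
    (hab : a ≤ b) : x ^ a ≤ M ^ a + M ^ (a - b) * x ^ b := by
  rcases le_or_gt x M with h | h
  · have := Real.rpow_le_rpow hx h ha
    have : 0 ≤ M ^ (a - b) * x ^ b := by positivity
    linarith
  · have hx0 : 0 < x := hM.trans h
    have h1 : x ^ (a - b) ≤ M ^ (a - b) :=
      Real.rpow_le_rpow_of_nonpos hM h.le (by linarith)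
    have h2 : x ^ a = x ^ (a - b) * x ^ b := by
      rw [← Real.rpow_add hx0]
      ring_nf
    have h3 : x ^ (a - b) * x ^ b ≤ M ^ (a - b) * x ^ b := by gcongr
    have : 0 ≤ M ^ a := by positivity
    linarith

theorem Finset.sum_rpow_le_of_sum_pow_le {V : Type*} {A : Finset V} (hA : A.Nonempty)
    (d : V → ℕ) {s K : ℕ} (hs : 1 ≤ s) (hd : ∑ v ∈ A, d v ^ s ≤ K * A.card ^ s) {a : ℝ}
    (ha : 0 ≤ a) (has : a ≤ s) :
    ∑ v ∈ A, (d v : ℝ) ^ a ≤ (1 + K) * (A.card : ℝ) ^ (1 + a * (1 - 1 / (s : ℝ))) := by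
  have hn : (0 : ℝ) < A.card := by exact_mod_cast hA.card_pos
  have hs0 : (s : ℝ) ≠ 0 := by positivity
  set n : ℝ := (A.card : ℝ) with hndef
  -- The threshold that balances the two terms: `e1` and `e2` give the same power of `n`.
  set M : ℝ := n ^ (1 - 1 / (s : ℝ)) with hM
  have hM0 : 0 < M := Real.rpow_pos_of_pos hn _
  have hd' : ∑ v ∈ A, (d v : ℝ) ^ (s : ℝ) ≤ K * n ^ (s : ℝ) := by
    simp only [Real.rpow_natCast]
    rw [hndef]
    exact_mod_cast hd
  have e1 : n * M ^ a = n ^ (1 + a * (1 - 1 / (s : ℝ))) := by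
    rw [hM, ← Real.rpow_mul hn.le, Real.rpow_add hn, Real.rpow_one, mul_comm a]
  have e2 : M ^ (a - s) * n ^ (s : ℝ) = n ^ (1 + a * (1 - 1 / (s : ℝ))) := by
    rw [hM, ← Real.rpow_mul hn.le, ← Real.rpow_add hn]
    congr 1
    field_simp
    ring
  calc ∑ v ∈ A, (d v : ℝ) ^ a
      ≤ ∑ v ∈ A, (M ^ a + M ^ (a - s) * (d v : ℝ) ^ (s : ℝ)) :=
        Finset.sum_le_sum fun v _ =>
          Real.rpow_le_rpow_add_rpow_mul (Nat.cast_nonneg _) hM0 ha has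
    _ = n * M ^ a + M ^ (a - s) * ∑ v ∈ A, (d v : ℝ) ^ (s : ℝ) := by
        rw [Finset.sum_add_distrib, ← Finset.mul_sum]
        simp [hndef]
    _ ≤ n * M ^ a + M ^ (a - s) * (K * n ^ (s : ℝ)) := by gcongr
    _ = n * M ^ a + K * (M ^ (a - s) * n ^ (s : ℝ)) := by ring
    _ = _ := by
        rw [e1, e2]
        ring

/-! ### Counting cliques -/

namespace SimpleGraph

theorem card_cliquesIn_succ_le {V : Type*} (G : SimpleGraph V) (A : Finset V) (m : ℕ) :
    (G.cliquesIn A (m + 1)).card ≤ ∑ v ∈ A, (G.cliquesIn (G.nbrsIn A v) m).card := by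
  classical
  have hsub : G.cliquesIn A (m + 1) ⊆
      A.biUnion fun v => (G.cliquesIn (G.nbrsIn A v) m).image (insert v) := by
    intro K hK
    rw [mem_cliquesIn] at hK
    obtain ⟨⟨hKA, hcard⟩, hK⟩ := hK
    obtain ⟨v, hv⟩ : K.Nonempty := Finset.card_pos.1 (by omega)
    simp only [Finset.mem_biUnion, Finset.mem_image]
    refine ⟨v, hKA hv, K.erase v, ?_, Finset.insert_erase hv⟩
    rw [mem_cliquesIn]
    refine ⟨⟨fun w hw => ?_, ?_⟩, hK.subset (by simp)⟩
    · rw [Finset.mem_erase] at hw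
      simp only [nbrsIn, Finset.mem_filter]
      exact ⟨hKA hw.2, hK hv hw.2 hw.1.symm⟩
    · rw [Finset.card_erase_of_mem hv, hcard]
      rfl
  calc _ ≤ _ := Finset.card_le_card hsub
    _ ≤ _ := Finset.card_biUnion_le
    _ ≤ _ := Finset.sum_le_sum fun v _ => Finset.card_image_le

/-- A graph in which every `s` vertices have fewer than `t` common neighbours has
`O(n ^ (k - k(k-1)/(2s)))` cliques with `k = m + 1 ≤ s` vertices. -/
theorem exists_card_cliquesIn_le (m : ℕ) : ∀ s t : ℕ, m + 1 ≤ s → ∃ C : ℝ, 0 ≤ C ∧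
    ∀ (V : Type) (G : SimpleGraph V) (A : Finset V), G.FewCommonNbrs A s t →
      ((G.cliquesIn A (m + 1)).card : ℝ) ≤
        C * (A.card : ℝ) ^ ((m + 1 : ℝ) - (m + 1) * m / (2 * s)) := by
  induction m with
  | zero =>
    intro s t _
    refine ⟨1, zero_le_one, fun V G A _ => ?_⟩
    have h : (G.cliquesIn A 1).card ≤ A.card := by
      simpa using Finset.card_le_card
        (show G.cliquesIn A 1 ⊆ A.powersetCard 1 from fun K hK =>
          Finset.mem_powersetCard.2 (mem_cliquesIn.1 hK).1)
    simpa using h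
  | succ m ih =>
    intro s t hms
    obtain ⟨q, rfl⟩ : ∃ q, s = q + 1 := ⟨s - 1, by omega⟩
    have hmq : m + 1 ≤ q := by omega
    obtain ⟨C, hC, hbound⟩ := ih q t hmq
    refine ⟨C * (1 + ((q + 1) ^ (q + 1) * (1 + t) : ℕ)), by positivity, fun V G A hG => ?_⟩
    rcases A.eq_empty_or_nonempty with rfl | hA
    · have : (G.cliquesIn ∅ (m + 1 + 1)).card = 0 := by
        have := G.card_cliquesIn_succ_le ∅ (m + 1)
        simpa using this
      rw [this]
      push_cast
      positivity
    have hq : (m : ℝ) + 1 ≤ q := by exact_mod_cast hmq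
    have hq0 : (0 : ℝ) < q := by
      have : (0 : ℝ) ≤ m := Nat.cast_nonneg m
      linarith
    -- The inductive exponent inside a neighbourhood, where `s` has dropped to `q`.
    set a : ℝ := (m + 1 : ℝ) - (m + 1) * m / (2 * q) with ha
    have hfrac : 0 ≤ ((m : ℝ) + 1) * m / (2 * q) := by positivity
    have ha0 : 0 ≤ a := by
      rw [ha, sub_nonneg, div_le_iff₀ (by positivity)]
      have : (0 : ℝ) ≤ m := Nat.cast_nonneg m
      nlinarith
    have haq : a ≤ ((q + 1 : ℕ) : ℝ) := by
      push_cast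
      linarith
    have hexp : 1 + a * (1 - 1 / ((q + 1 : ℕ) : ℝ)) =
        ((m + 1 : ℕ) + 1 : ℝ) - ((m + 1 : ℕ) + 1) * (m + 1 : ℕ) / (2 * (q + 1 : ℕ)) := by
      rw [ha]
      push_cast
      field_simp
      ring
    have hsum := Finset.sum_rpow_le_of_sum_pow_le hA (fun v => (G.nbrsIn A v).card)
      (Nat.le_add_left 1 q) (hG.sum_pow_le (Nat.le_add_left 1 q)) ha0 haq
    rw [hexp] at hsum
    calc ((G.cliquesIn A (m + 1 + 1)).card : ℝ)
        ≤ ∑ v ∈ A, ((G.cliquesIn (G.nbrsIn A v) (m + 1)).card : ℝ) := by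
          exact_mod_cast G.card_cliquesIn_succ_le A (m + 1)
      _ ≤ ∑ v ∈ A, C * ((G.nbrsIn A v).card : ℝ) ^ a :=
          Finset.sum_le_sum fun v hv => hbound V G _ (hG.nbrsIn hv)
      _ = C * ∑ v ∈ A, ((G.nbrsIn A v).card : ℝ) ^ a := by rw [Finset.mul_sum]
      _ ≤ _ := by
          rw [mul_assoc]
          gcongr

end SimpleGraph

/-! ### From hypergraphs to graphs -/

/-- `M` matches pairs of vertices with edges of `H` that contain them. -/
structure Hypergraph.IsPairMatching {β : Type*} (H : Hypergraph β)
    (M : Set (Finset β × Set β)) : Prop where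
  card_eq_two : ∀ x ∈ M, x.1.card = 2
  mem_edgeSet : ∀ x ∈ M, x.2 ∈ H.edgeSet
  subset : ∀ x ∈ M, (x.1 : Set β) ⊆ x.2
  injOn_fst : Set.InjOn Prod.fst M
  injOn_snd : Set.InjOn Prod.snd M

/-- The graph formed by the matched pairs. -/
def pairGraph {β : Type*} [DecidableEq β] (M : Set (Finset β × Set β)) : SimpleGraph β where
  Adj a b := a ≠ b ∧ ({a, b} : Finset β) ∈ Prod.fst '' M
  symm := ⟨fun a b h => ⟨h.1.symm, by rw [Finset.pair_comm]; exact h.2⟩⟩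
  loopless := ⟨fun a h => h.1 rfl⟩

namespace Hypergraph

variable {β : Type*} [DecidableEq β] {H : Hypergraph β} {M : Set (Finset β × Set β)}

/-- A copy of `F` in the graph of matched pairs extends to a Berge-`F`. -/
theorem IsPairMatching.not_bergeFree (hM : H.IsPairMatching M) (hV : H.vertexSet = Set.univ)
    {W : Type*} {F : SimpleGraph W} (φ : W ↪ β)
    (hφ : ∀ a b, F.Adj a b → (pairGraph M).Adj (φ a) (φ b)) : ¬ H.BergeFree F := by
  have key : ∀ e : F.edgeSet, ∃ x ∈ M, ∀ v, v ∈ x.1 ↔ ∃ w ∈ (e : Sym2 W), φ w = v := by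
    rintro ⟨e, he⟩
    induction e with | _ a b
    obtain ⟨-, x, hx, hab⟩ := hφ a b he
    refine ⟨x, hx, fun v => ?_⟩
    simp [hab, eq_comm]
  choose x hxM hx using key
  -- A hyperedge determines its matched pair, which determines the edge of `F`.
  have hinj : Function.Injective fun e => (x e).2 := by
    intro e e' h
    have hxe : x e = x e' := hM.injOn_snd (hxM e) (hxM e') h
    ext w
    have h1 := hx e (φ w)
    have h2 := hx e' (φ w)
    rw [hxe, h2] at h1
    simpa using h1.symm
  intro hH
  refine hH ⟨H.vertexSet, Set.range fun e => (x e).2, ?_⟩ ⟨subset_rfl, ?_⟩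
    ⟨φ, fun w => by simp [hV], Equiv.ofInjective _ hinj, fun e w hw => ?_⟩
  · rintro _ ⟨e, rfl⟩
    simp [hV]
  · rintro _ ⟨e, rfl⟩
    exact hM.mem_edgeSet _ (hxM e)
  · exact hM.subset _ (hxM e) ((hx e _).2 ⟨w, hw, rfl⟩)

theorem IsPairMatching.fewCommonNbrs [Fintype β] (hM : H.IsPairMatching M)
    (hV : H.vertexSet = Set.univ) {s t : ℕ}
    (hH : H.BergeFree (completeBipartiteGraph (Fin s) (Fin t))) :
    (pairGraph M).FewCommonNbrs Finset.univ s t := by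
  classical
  intro S _ hS T₀ _ hadj₀
  by_contra! hT₀
  obtain ⟨T, hTsub, hT⟩ := Finset.exists_subset_card_eq hT₀
  have hadj : ∀ v ∈ T, ∀ u ∈ S, (pairGraph M).Adj v u := fun v hv => hadj₀ v (hTsub hv)
  let f : Fin s ≃ S := (Finset.equivFinOfCardEq hS).symm
  let g : Fin t ≃ T := (Finset.equivFinOfCardEq hT).symm
  have hinj : Function.Injective (Sum.elim (fun i => (f i : β)) (fun j => (g j : β))) := by
    refine Function.Injective.sumElim (Subtype.val_injective.comp f.injective)
      (Subtype.val_injective.comp g.injective) fun i j h => ?_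
    exact (hadj _ (g j).2 _ (f i).2).ne h.symm
  refine hM.not_bergeFree hV ⟨_, hinj⟩ ?_ hH
  rintro (i | i) (j | j) h
  · simp at h
  · exact (hadj _ (g j).2 _ (f i).2).symm
  · exact hadj _ (g i).2 _ (f j).2
  · simp at h

/-- A maximal matching leaves unmatched only edges all of whose pairs are matched. -/
theorem exists_isPairMatching_maximal [Finite β] (H : Hypergraph β) :
    ∃ M, H.IsPairMatching M ∧ ∀ e ∈ H.edgeSet, e ∉ Prod.snd '' M →
      (pairGraph M).IsClique e := by
  obtain ⟨M, hM⟩ : ∃ M, Maximal H.IsPairMatching M := by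
    refine Set.Finite.exists_maximal (Set.toFinite _) ⟨∅, ?_⟩
    constructor <;> simp
  refine ⟨M, hM.prop, fun e he heM a ha b hb hab => ⟨hab, ?_⟩⟩
  by_contra hp
  -- An unmatched pair in an unmatched hyperedge would enlarge the matching.
  have hnew : H.IsPairMatching (insert (({a, b} : Finset β), e) M) := by
    have h := hM.prop
    refine ⟨?_, ?_, ?_, ?_, ?_⟩
    · rintro x (rfl | hx)
      · exact Finset.card_pair hab
      · exact h.card_eq_two x hx
    · rintro x (rfl | hx)
      · exact he
      · exact h.mem_edgeSet x hx
    · rintro x (rfl | hx)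
      · simp [Set.insert_subset_iff, ha, hb]
      · exact h.subset x hx
    · rw [Set.injOn_insert fun hx => hp ⟨_, hx, rfl⟩]
      exact ⟨h.injOn_fst, hp⟩
    · rw [Set.injOn_insert fun hx => hp ⟨_, hx, rfl⟩]
      exact ⟨h.injOn_snd, heM⟩
  exact hp ⟨_, hM.le_of_ge hnew (Set.subset_insert _ _) (Set.mem_insert _ _), rfl⟩

theorem IsPairMatching.ncard_edgeSet_le [Fintype β] (hM : H.IsPairMatching M) {r : ℕ}
    (hr : H.IsUniform r)
    (hmax : ∀ e ∈ H.edgeSet, e ∉ Prod.snd '' M → (pairGraph M).IsClique e) :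
    H.edgeSet.ncard ≤ ((pairGraph M).cliquesIn Finset.univ r).card +
      ((pairGraph M).cliquesIn Finset.univ 2).card := by
  classical
  have h1 : H.edgeSet ⊆ ((fun K : Finset β => (K : Set β)) ''
      ((pairGraph M).cliquesIn Finset.univ r : Set (Finset β))) ∪ Prod.snd '' M := by
    intro e he
    by_cases heM : e ∈ Prod.snd '' M
    · exact Or.inr heM
    refine Or.inl ⟨e.toFinset, ?_, by simp⟩
    have hcard : e.toFinset.card = r := by
      have := hr e he
      rw [Set.encard_eq_coe_toFinset_card] at this
      exact_mod_cast this
    rw [Finset.mem_coe, SimpleGraph.mem_cliquesIn]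
    exact ⟨⟨Finset.subset_univ _, hcard⟩, by simpa using hmax e he heM⟩
  have h2 : Prod.fst '' M ⊆ ((pairGraph M).cliquesIn Finset.univ 2 : Set (Finset β)) := by
    rintro p ⟨x, hx, rfl⟩
    rw [Finset.mem_coe, SimpleGraph.mem_cliquesIn]
    refine ⟨⟨Finset.subset_univ _, hM.card_eq_two x hx⟩, ?_⟩
    obtain ⟨a, b, hab, hx2⟩ := Finset.card_eq_two.1 (hM.card_eq_two x hx)
    rw [hx2, Finset.coe_pair, SimpleGraph.isClique_pair]
    exact fun _ => ⟨hab, x, hx, hx2⟩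
  calc H.edgeSet.ncard ≤ _ := Set.ncard_le_ncard h1 (Set.toFinite _)
    _ ≤ _ := Set.ncard_union_le _ _
    _ ≤ _ := by
      gcongr
      · refine (Set.ncard_image_le (Set.toFinite _)).trans ?_
        rw [Set.ncard_coe_finset]
      · rw [hM.injOn_snd.ncard_image, ← hM.injOn_fst.ncard_image,
          ← Set.ncard_coe_finset]
        exact Set.ncard_le_ncard h2 (Set.toFinite _)

end Hypergraph

theorem mainTheorem3 (r s t : ℕ) (hr : 3 ≤ r) (hrs : r ≤ s) (hst : s ≤ t) :
    ∃ C : ℝ, 0 < C ∧ ∃ n₀ : ℕ, ∀ n : ℕ, n₀ ≤ n →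
      (bergeEx r n (completeBipartiteGraph (Fin s) (Fin t)) : ℝ) ≤
        C * (n : ℝ) ^ ((r : ℝ) - (r : ℝ) * ((r : ℝ) - 1) / (2 * (s : ℝ))) := by
  obtain ⟨k, rfl⟩ : ∃ k, r = k + 1 := ⟨r - 1, by omega⟩
  obtain ⟨C₁, hC₁, h₁⟩ := SimpleGraph.exists_card_cliquesIn_le k s t hrs
  obtain ⟨C₂, hC₂, h₂⟩ := SimpleGraph.exists_card_cliquesIn_le 1 s t (by omega)
  -- The `+ 1` only makes the constant positive; `n ≥ 1` makes powers of `n` monotone in the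
  -- exponent.
  refine ⟨C₁ + C₂ + 1, by positivity, 1, fun n hn => ?_⟩
  have hF : (completeBipartiteGraph (Fin s) (Fin t)).edgeSet.Nonempty :=
    ⟨s(Sum.inl ⟨0, by omega⟩, Sum.inr ⟨0, by omega⟩), by simp⟩
  obtain ⟨H, hV, hunif, hfree, hcard⟩ := (bergeEx_isGreatest (k + 1) n _ hF).1
  obtain ⟨M, hM, hmax⟩ := H.exists_isPairMatching_maximal
  have hG := hM.fewCommonNbrs hV hfree
  have hle := hM.ncard_edgeSet_le hunif hmax
  have b₁ := h₁ _ _ _ hG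
  have b₂ := h₂ _ _ _ hG
  rw [hcard] at hle
  simp only [Finset.card_univ, Fintype.card_fin] at b₁ b₂
  have hn1 : (1 : ℝ) ≤ n := by exact_mod_cast hn
  -- The edge count of G is of no larger order than the clique bound.
  have hexp : (((1 : ℕ) : ℝ) + 1) - (((1 : ℕ) : ℝ) + 1) * ((1 : ℕ) : ℝ) / (2 * s) ≤
      ((k : ℝ) + 1) - (k + 1) * k / (2 * s) := by
    have hs : (0 : ℝ) < s := by
      have : 0 < s := by omega
      exact_mod_cast this
    have hks : (k : ℝ) + 1 ≤ s := by exact_mod_cast hrs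
    have hk : (2 : ℝ) ≤ k := by
      have : 2 ≤ k := by omega
      exact_mod_cast this
    have : ((k : ℝ) + 1) - (k + 1) * k / (2 * s) - (2 - 1 / s) =
        (k - 1) * (2 * s - (k + 2)) / (2 * s) := by
      field_simp
      ring
    have h0 : 0 ≤ ((k : ℝ) - 1) * (2 * s - (k + 2)) / (2 * s) :=
      div_nonneg (mul_nonneg (by linarith) (by linarith)) (by linarith)
    have h2 : (((1 : ℕ) : ℝ) + 1) - (((1 : ℕ) : ℝ) + 1) * ((1 : ℕ) : ℝ) / (2 * s) = 2 - 1 / s := by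
      push_cast
      field_simp
      ring
    rw [h2]
    linarith
  have hexp' : (((k + 1 : ℕ) : ℝ) - ((k + 1 : ℕ) : ℝ) * (((k + 1 : ℕ) : ℝ) - 1) / (2 * (s : ℝ))) =
      ((k : ℝ) + 1) - (k + 1) * k / (2 * s) := by
    push_cast
    ring
  rw [hexp']
  have hpow := Real.rpow_le_rpow_of_exponent_le hn1 hexp
  have hle' : (bergeEx (k + 1) n (completeBipartiteGraph (Fin s) (Fin t)) : ℝ) ≤
      (((pairGraph M).cliquesIn Finset.univ (k + 1)).card : ℝ) +
        (((pairGraph M).cliquesIn Finset.univ (1 + 1)).card : ℝ) := by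
    exact_mod_cast hle
  have b₃ := mul_le_mul_of_nonneg_left hpow hC₂
  have : (0 : ℝ) ≤ (n : ℝ) ^ (((k : ℝ) + 1) - (k + 1) * k / (2 * s)) := by positivity
  linarith
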